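/- Let $\zeta$ denote the Riemann zeta function and write $s=\sigma+it$ for a complex variable. For every integer $k\ge 9$, the function $\zeta^k(2s)+\zeta^k(3s)$ has infinitely many zeros in the half-plane $\sigma>1$. On the other hand, for every integer $k$ with $1\le k\le 5$, the function $\zeta^k(2s)+\zeta^k(3s)$ has no zeros in the half-plane $\sigma>1$. Here $\zeta^k(w)=\zeta(w)^k$. -/

import Mathlib

/-!
For `re s > 1` neither `ζ(2s)` nor `ζ(3s)` vanishes, and the Euler product gives
`ζ(2s) / ζ(3s) = exp (∑ p, h (p ^ (-s)))` with `h z = log (1 - z ^ 3) - log (1 - z ^ 2)`, so that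
`exp (h z) = 1 + z ^ 2 / (1 + z)`. A point `s` is therefore a zero exactly when `k ∑ p, h (p ^ (-s))`
is an odd multiple of `π i` (`riemannZeta_pow_add_pow_eq_zero_iff`).

For `k ≤ 5` the imaginary part of the sum is too small: it is less than `π / 5` in absolute value
(`abs_twistedLog_im_lt`). The harmonic function `im h` on `|z| ≤ 1 / p` is largest on the boundary
circle, where for `p = 2, 3, 5` the bound is the positivity of a quartic polynomial; for `p ≥ 7` the
estimate `|exp (h z) - 1| ≤ |z| ^ 2 / (1 - |z|)` is enough, and the tail is summed by comparison with
`log ζ(2) = log (π ^ 2 / 6)`.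

For `k ≥ 9` the value `π i / k` is attained infinitely often. Replace `p ^ (-s)` by `χ p * p ^ (-s)`
with free phases `χ p` on the unit circle (`twistedLog`). For each modulus `r = p ^ (-σ)` there is a
phase making `h` purely imaginary with nonnegative imaginary part; at `σ = 1` the prime `2` alone
gives more than `π / 9`, so by the intermediate value theorem in `σ` the twisted sum equals `π i / k`
at some `σ > 1` (`exists_twistedLog_eq_mul_I`). By Kronecker's theorem
(`exists_circle_exp_neg_log_mem`) the phases `p ^ (-i T)`, with `T` arbitrarily large, approximate
`χ`, and by a form of Hurwitz's theorem (`exists_ball_forall_near_exists_eq`) the sum shifted by `i T`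
takes the value `π i / k` near `σ` (`infinite_setOf_twistedLog_eq`).
-/

/-! ### Kronecker's theorem for linearly independent frequencies -/

open Filter Topology in
/-- A coefficient of an exponential polynomial with distinct real frequencies is its mean against
the conjugate exponential, so any bound valid on a half-line bounds every coefficient. -/
theorem norm_coeff_le_of_norm_exp_sum_le {κ : Type*} (s : Finset κ) (a : κ → ℂ) (μ : κ → ℝ)
    (hμ : Set.InjOn μ s) {B T₀ : ℝ}
    (hB : ∀ t : ℝ, T₀ ≤ t → ‖∑ i ∈ s, a i * Complex.exp (Complex.I * (t * μ i))‖ ≤ B)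
    {j : κ} (hj : j ∈ s) : ‖a j‖ ≤ B := by
  classical
  set e : κ → ℝ → ℂ := fun i t => Complex.exp ((Complex.I * (μ i - μ j : ℝ)) * t) with he
  have hlim : ∀ i ∈ s, Tendsto (fun T : ℝ => ((T : ℂ))⁻¹ * ∫ t in T₀..(T₀ + T), e i t) atTop
      (𝓝 (if i = j then 1 else 0)) := by
    intro i hi
    by_cases hij : i = j
    · subst hij
      simp only [if_true, he, sub_self, Complex.ofReal_zero, mul_zero, zero_mul, Complex.exp_zero,
        intervalIntegral.integral_const, add_sub_cancel_left]
      refine tendsto_const_nhds.congr' ?_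
      filter_upwards [eventually_gt_atTop 0] with T hT
      have : (T : ℂ) ≠ 0 := by exact_mod_cast hT.ne'
      simp [this]
    · rw [if_neg hij]
      have hne : μ i - μ j ≠ 0 := sub_ne_zero.2 fun h => hij (hμ hi hj h)
      have hc : Complex.I * ((μ i - μ j : ℝ) : ℂ) ≠ 0 :=
        mul_ne_zero Complex.I_ne_zero (by exact_mod_cast hne)
      have hn : ∀ t, ‖e i t‖ = 1 := by
        intro t
        have : Complex.I * ((μ i - μ j : ℝ) : ℂ) * t = (((μ i - μ j) * t : ℝ) : ℂ) * Complex.I := by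
          push_cast; ring
        simp only [he]
        rw [this, Complex.norm_exp_ofReal_mul_I]
      have hb : Tendsto (fun T : ℝ => T⁻¹ * (2 / |μ i - μ j|)) atTop (𝓝 0) := by
        simpa using tendsto_inv_atTop_zero.mul_const (2 / |μ i - μ j|)
      refine squeeze_zero_norm' ?_ hb
      filter_upwards [eventually_gt_atTop 0] with T hT
      rw [norm_mul, norm_inv, Complex.norm_real, Real.norm_of_nonneg hT.le]
      refine mul_le_mul_of_nonneg_left ?_ (by positivity)
      simp only [he]
      rw [integral_exp_mul_complex hc, norm_div, norm_mul, Complex.norm_I, one_mul,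
        Complex.norm_real, Real.norm_eq_abs]
      gcongr
      refine (norm_sub_le _ _).trans ?_
      have h1 := hn (T₀ + T)
      have h2 := hn T₀
      simp only [he] at h1 h2
      rw [h1, h2]; norm_num
  have hsum : Tendsto (fun T : ℝ => ∑ i ∈ s, a i * (((T : ℂ))⁻¹ * ∫ t in T₀..(T₀ + T), e i t))
      atTop (𝓝 (∑ i ∈ s, a i * (if i = j then 1 else 0))) :=
    tendsto_finsetSum _ fun i hi => (hlim i hi).const_mul _
  have hval : ∑ i ∈ s, a i * (if i = j then (1 : ℂ) else 0) = a j := by simp [hj]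
  rw [hval] at hsum
  refine le_of_tendsto hsum.norm ?_
  filter_upwards [eventually_gt_atTop 0] with T hT
  have hcont : ∀ i, Continuous (e i) := fun i => by simp only [he]; fun_prop
  have hint : ∑ i ∈ s, a i * (((T : ℂ))⁻¹ * ∫ t in T₀..(T₀ + T), e i t)
      = ((T : ℂ))⁻¹ * ∫ t in T₀..(T₀ + T), ∑ i ∈ s, a i * e i t := by
    rw [intervalIntegral.integral_finsetSum
      fun i _ => ((hcont i).const_mul (a i)).intervalIntegrable _ _, Finset.mul_sum]
    refine Finset.sum_congr rfl fun i _ => ?_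
    rw [intervalIntegral.integral_const_mul]; ring
  rw [hint, norm_mul, norm_inv, Complex.norm_real, Real.norm_of_nonneg hT.le]
  have hbound : ‖∫ t in T₀..(T₀ + T), ∑ i ∈ s, a i * e i t‖ ≤ B * |T₀ + T - T₀| := by
    refine intervalIntegral.norm_integral_le_of_norm_le_const fun t ht => ?_
    rw [Set.uIoc_of_le (by linarith)] at ht
    have : ∑ i ∈ s, a i * e i t
        = (∑ i ∈ s, a i * Complex.exp (Complex.I * (t * μ i)))
          * Complex.exp (((-(t * μ j) : ℝ) : ℂ) * Complex.I) := by
      rw [Finset.sum_mul]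
      refine Finset.sum_congr rfl fun i _ => ?_
      simp only [he]
      rw [mul_assoc (a i) (Complex.exp _), ← Complex.exp_add]
      congr 2
      push_cast; ring
    rw [this, norm_mul, Complex.norm_exp_ofReal_mul_I, mul_one]
    exact hB t ht.1.le
  rw [add_sub_cancel_left, abs_of_pos hT] at hbound
  rw [inv_mul_le_iff₀ hT]
  linarith

open Filter Topology in
/-- **Kronecker's theorem**, Bohr's proof. If the phases stayed away from `a`, then
`∏ i, (1 + conj (a i) * exp (I t μ i))` would be at most `2 ^ n * ρ` in norm with `ρ < 1`. The
coefficients of its `N`-th power would then be at most `(2 ^ n * ρ) ^ N`, while their sum is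
`2 ^ (n * N)` and there are only `(N + 1) ^ n` of them. -/
theorem exists_exp_mul_near {ι : Type*} [Fintype ι] (μ : ι → ℝ)
    (hμ : Function.Injective fun m : ι → ℕ => ∑ i, (m i : ℝ) * μ i) (a : ι → ℂ)
    (ha : ∀ i, ‖a i‖ = 1) {ε : ℝ} (hε : 0 < ε) (T₀ : ℝ) :
    ∃ t : ℝ, T₀ ≤ t ∧ ∀ i, ‖Complex.exp (Complex.I * (t * μ i)) - a i‖ < ε := by
  classical
  by_contra! hcon
  -- Shrinking `ε` keeps `4 - ε ^ 2` positive.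
  set ε' := min ε 1 with hε'
  have hε'0 : 0 < ε' := lt_min hε one_pos
  have hε'1 : ε' ≤ 1 := min_le_right _ _
  set ρ : ℝ := Real.sqrt (1 - ε' ^ 2 / 4) with hρ
  have hρ1 : ρ < 1 := by
    rw [hρ, Real.sqrt_lt' one_pos]; nlinarith
  have hρ0 : 0 ≤ ρ := Real.sqrt_nonneg _
  set n := Fintype.card ι with hn
  set b : ι → ℂ := fun i => (starRingEnd ℂ) (a i) with hb
  have hbn : ∀ i, ‖b i‖ = 1 := fun i => by simp [hb, ha]
  have hba : ∀ i, b i * a i = 1 := fun i => by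
    simp only [hb]; rw [mul_comm, Complex.mul_conj, Complex.normSq_eq_norm_sq, ha]; simp
  set u : ι → ℝ → ℂ := fun i t => b i * Complex.exp (Complex.I * (t * μ i)) with hu
  have hun : ∀ i t, ‖u i t‖ = 1 := by
    intro i t
    have : Complex.I * (t * μ i) = ((t * μ i : ℝ) : ℂ) * Complex.I := by push_cast; ring
    simp only [hu]
    rw [norm_mul, hbn, this, Complex.norm_exp_ofReal_mul_I, one_mul]
  have hle2 : ∀ i t, ‖1 + u i t‖ ≤ 2 := fun i t => by
    refine (norm_add_le _ _).trans ?_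
    rw [hun]; norm_num
  have hprod : ∀ t, T₀ ≤ t → ‖∏ i, (1 + u i t)‖ ≤ 2 ^ n * ρ := by
    intro t ht
    obtain ⟨i, hi⟩ := hcon t ht
    have hi' : ε' ≤ ‖u i t - 1‖ := by
      have : u i t - 1 = b i * (Complex.exp (Complex.I * (t * μ i)) - a i) := by
        rw [mul_sub, hba]
      rw [this, norm_mul, hbn, one_mul]
      exact (min_le_left _ _).trans hi
    have hpar := parallelogram_law_with_norm ℝ (1 : ℂ) (u i t)
    rw [hun, norm_one, norm_sub_rev] at hpar
    have h2 : ‖1 + u i t‖ ≤ 2 * ρ := by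
      refine abs_le_of_sq_le_sq' ?_ (by positivity) |>.2
      rw [mul_pow, hρ, Real.sq_sqrt (by nlinarith)]
      nlinarith
    rw [norm_prod, ← Finset.mul_prod_erase _ _ (Finset.mem_univ i)]
    have h3 : ∏ j ∈ Finset.univ.erase i, ‖1 + u j t‖ ≤ 2 ^ (n - 1) := by
      refine (Finset.prod_le_prod (fun _ _ => norm_nonneg _) fun j _ => hle2 j t).trans ?_
      simp [hn]
    have hn1 : 2 ^ n = (2 : ℝ) * 2 ^ (n - 1) := by
      have : 0 < n := Fintype.card_pos_iff.2 ⟨i⟩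
      rw [← pow_succ']; congr 1; omega
    calc _ ≤ (2 * ρ) * 2 ^ (n - 1) := by gcongr
      _ = _ := by rw [hn1]; ring
  have hexpand : ∀ N : ℕ, ∀ t, (∏ i, (1 + u i t)) ^ N
      = ∑ m ∈ Fintype.piFinset (fun _ : ι => Finset.range (N + 1)),
        (∏ i, b i ^ m i * (N.choose (m i) : ℂ))
          * Complex.exp (Complex.I * (t * ((∑ i, (m i : ℝ) * μ i : ℝ) : ℂ))) := by
    intro N t
    rw [← Finset.prod_pow]
    have : ∀ i, (1 + u i t) ^ N = ∑ k ∈ Finset.range (N + 1), u i t ^ k * (N.choose k : ℂ) := by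
      intro i
      rw [add_comm, add_pow]; simp
    simp_rw [this]
    rw [Finset.prod_univ_sum]
    refine Finset.sum_congr rfl fun m _ => ?_
    have hx : Complex.exp (Complex.I * (t * ((∑ i, (m i : ℝ) * μ i : ℝ) : ℂ)))
        = ∏ i, Complex.exp (Complex.I * (t * μ i)) ^ m i := by
      simp_rw [← Complex.exp_nat_mul]
      rw [← Complex.exp_sum]
      congr 1
      push_cast
      rw [Finset.mul_sum, Finset.mul_sum]
      exact Finset.sum_congr rfl fun i _ => by ring
    rw [hx, ← Finset.prod_mul_distrib]
    refine Finset.prod_congr rfl fun i _ => ?_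
    simp only [hu]; ring
  have hcoef : ∀ N : ℕ, ∀ m ∈ Fintype.piFinset (fun _ : ι => Finset.range (N + 1)),
      (∏ i, (N.choose (m i) : ℝ)) ≤ (2 ^ n * ρ) ^ N := by
    intro N m hm
    have := norm_coeff_le_of_norm_exp_sum_le (Fintype.piFinset fun _ : ι => Finset.range (N + 1))
      (fun m => ∏ i, b i ^ m i * (N.choose (m i) : ℂ)) (fun m => ∑ i, (m i : ℝ) * μ i)
      (hμ.injOn) (B := (2 ^ n * ρ) ^ N) (T₀ := T₀) (fun t ht => by
        rw [← hexpand N t, norm_pow]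
        exact pow_le_pow_left₀ (norm_nonneg _) (hprod t ht) N) hm
    simpa [norm_prod, hbn] using this
  have hmain : ∀ N : ℕ, (1 : ℝ) ≤ ((N : ℝ) + 1) ^ n * ρ ^ N := by
    intro N
    have h1 : ∑ m ∈ Fintype.piFinset (fun _ : ι => Finset.range (N + 1)),
        (∏ i, (N.choose (m i) : ℝ)) = (2 ^ n) ^ N := by
      rw [← Finset.prod_univ_sum (fun _ : ι => Finset.range (N + 1))
        (fun _ k => (N.choose k : ℝ))]
      have : ∑ k ∈ Finset.range (N + 1), (N.choose k : ℝ) = 2 ^ N := by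
        exact_mod_cast Nat.sum_range_choose N
      rw [this, Finset.prod_const, Finset.card_univ, ← pow_mul, ← pow_mul, mul_comm]
    have h2 := Finset.sum_le_card_nsmul _ _ _ (hcoef N)
    rw [h1] at h2
    simp only [Fintype.card_piFinset, Finset.card_range, Finset.prod_const, Finset.card_univ,
      nsmul_eq_mul, Nat.cast_pow, Nat.cast_add, Nat.cast_one] at h2
    rw [mul_pow] at h2
    have h3 : (0 : ℝ) < (2 ^ n) ^ N := by positivity
    refine le_of_mul_le_mul_left ?_ h3
    calc _ = ((2 : ℝ) ^ n) ^ N := mul_one _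
      _ ≤ _ := h2
      _ = _ := by ring
  have hlim : Tendsto (fun N : ℕ => ((N : ℝ) + 1) ^ n * ρ ^ N) atTop (𝓝 0) := by
    rcases eq_or_lt_of_le hρ0 with h0 | h0
    · refine tendsto_const_nhds.congr' ?_
      filter_upwards [eventually_ge_atTop 1] with N hN
      rw [← h0, zero_pow (by omega), mul_zero]
    · have h := (tendsto_add_atTop_iff_nat 1).2
        (tendsto_pow_const_mul_const_pow_of_abs_lt_one n (r := ρ) (by rwa [abs_of_nonneg hρ0]))
      have h' := h.mul_const ρ⁻¹
      rw [zero_mul] at h'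
      refine h'.congr fun N => ?_
      push_cast
      rw [pow_succ]; field_simp
  exact absurd (ge_of_tendsto' hlim hmain) (by norm_num)

/-- Unique factorization: the logarithms of finitely many primes are linearly independent. -/
theorem injective_sum_mul_neg_log_primes (S : Finset Nat.Primes) :
    Function.Injective fun m : S → ℕ => ∑ p : S, (m p : ℝ) * (-Real.log (p : Nat.Primes)) := by
  intro m m' h
  have key : ∀ m : S → ℕ, ∑ p : S, (m p : ℝ) * (-Real.log (p : Nat.Primes))
      = -Real.log ((∏ p : S, ((p : Nat.Primes) : ℕ) ^ m p : ℕ) : ℝ) := by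
    intro m
    push_cast
    rw [Real.log_prod (fun p _ => pow_ne_zero _ (by exact_mod_cast p.1.2.ne_zero)),
      ← Finset.sum_neg_distrib]
    refine Finset.sum_congr rfl fun p _ => ?_
    rw [Real.log_pow]; ring
  simp only [key, neg_inj] at h
  have hpos : ∀ m : S → ℕ, (0 : ℝ) < ((∏ p : S, ((p : Nat.Primes) : ℕ) ^ m p : ℕ) : ℝ) := fun m => by
    exact_mod_cast Finset.prod_pos fun (p : S) _ => pow_pos p.1.2.pos (m p)
  have h2 : (∏ p : S, ((p : Nat.Primes) : ℕ) ^ m p) = ∏ p : S, ((p : Nat.Primes) : ℕ) ^ m' p := by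
    exact_mod_cast Real.log_injOn_pos (hpos m) (hpos m') h
  have hfac : ∀ m : S → ℕ, ∀ q : S,
      (∏ p : S, ((p : Nat.Primes) : ℕ) ^ m p).factorization ((q : Nat.Primes) : ℕ) = m q := by
    intro m q
    rw [Nat.factorization_prod fun p _ => pow_ne_zero _ p.1.2.ne_zero, Finset.sum_apply',
      Finset.sum_eq_single q]
    · rw [Nat.Prime.factorization_pow q.1.2]; simp
    · intro p _ hpq
      rw [Nat.Prime.factorization_pow p.1.2]
      refine Finsupp.single_eq_of_ne fun h => hpq ?_
      exact (Subtype.ext (Subtype.ext h)).symm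
    · simp
  funext q
  rw [← hfac m q, h2, hfac m' q]

open Filter Topology in
/-- The points `(p ^ (-i T))_p` with `T ≥ T₀` are dense in the infinite torus. -/
theorem exists_circle_exp_neg_log_mem (χ : Nat.Primes → Circle) {U : Set (Nat.Primes → Circle)}
    (hU : U ∈ 𝓝 χ) (T₀ : ℝ) :
    ∃ T : ℝ, T₀ ≤ T ∧ (fun p : Nat.Primes => Circle.exp (-(T * Real.log p))) ∈ U := by
  rw [nhds_pi, Filter.mem_pi'] at hU
  obtain ⟨S, V, hV, hSV⟩ := hU
  have : ∀ p, ∃ ε > 0, Metric.ball (χ p) ε ⊆ V p := fun p => Metric.mem_nhds_iff.1 (hV p)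
  choose ε hε hεV using this
  obtain ⟨δ, hδ, hδε⟩ : ∃ δ > 0, ∀ p ∈ S, δ ≤ ε p := by
    rcases S.eq_empty_or_nonempty with h | h
    · exact ⟨1, one_pos, by simp [h]⟩
    · exact ⟨S.inf' h ε, (Finset.lt_inf'_iff h).2 fun p _ => hε p, fun p hp => Finset.inf'_le _ hp⟩
  obtain ⟨T, hT, h⟩ := exists_exp_mul_near _ (injective_sum_mul_neg_log_primes S)
    (fun p => (χ p : ℂ)) (fun p => Circle.norm_coe _) hδ T₀
  refine ⟨T, hT, hSV fun p hp => hεV p ?_⟩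
  rw [Metric.mem_ball]
  change dist (Circle.exp (-(T * Real.log ((p : ℕ) : ℝ))) : ℂ) (χ p : ℂ) < ε p
  rw [dist_eq_norm]
  refine lt_of_lt_of_le ?_ (hδε p hp)
  have := h ⟨p, hp⟩
  have hexp : ((Circle.exp (-(T * Real.log ((p : ℕ) : ℝ))) : Circle) : ℂ)
      = Complex.exp (Complex.I * (T * ((-Real.log ((p : ℕ) : ℝ) : ℝ) : ℂ))) := by
    rw [Circle.coe_exp]
    congr 1
    push_cast; ring
  rw [hexp]
  exact this

/-! ### Stability of solutions of holomorphic equations -/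

open Filter Topology Metric in
/-- A form of Hurwitz's theorem: every holomorphic function uniformly close to a nonconstant `G` near
`s₀` takes the value `G s₀` near `s₀`. -/
theorem exists_ball_forall_near_exists_eq {U : Set ℂ} (hU : IsOpen U) (hU' : IsPreconnected U)
    {G : ℂ → ℂ} (hG : DifferentiableOn ℂ G U) {s₀ s₁ : ℂ} (hs₀ : s₀ ∈ U) (hs₁ : s₁ ∈ U)
    (hne : G s₁ ≠ G s₀) :
    ∃ r > 0, closedBall s₀ r ⊆ U ∧ ∃ ε > 0, ∀ F : ℂ → ℂ, DifferentiableOn ℂ F U →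
      (∀ s ∈ closedBall s₀ r, ‖F s - G s‖ < ε) → ∃ s ∈ closedBall s₀ r, F s = G s₀ := by
  have hGa := hG.analyticOnNhd hU
  have hev : ∀ᶠ z in 𝓝[≠] s₀, G z ≠ G s₀ := by
    rcases (hGa s₀ hs₀).eventually_eq_or_eventually_ne
      (analyticAt_const (v := G s₀)) with h | h
    · exact absurd (hGa.eqOn_of_preconnected_of_eventuallyEq analyticOnNhd_const hU' hs₀ h hs₁) hne
    · exact h
  rw [eventually_nhdsWithin_iff] at hev
  obtain ⟨r, hr, hrsub⟩ := nhds_basis_closedBall.mem_iff.1 (hev.and (hU.mem_nhds hs₀))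
  have hrU : closedBall s₀ r ⊆ U := fun z hz => (hrsub hz).2
  have hcont : ContinuousOn (fun z => ‖G z - G s₀‖) (sphere s₀ r) :=
    ((hG.continuousOn.mono (sphere_subset_closedBall.trans hrU)).sub continuousOn_const).norm
  obtain ⟨z₁, hz₁, hmin⟩ := (isCompact_sphere s₀ r).exists_isMinOn
    (NormedSpace.sphere_nonempty.2 hr.le) hcont
  set m := ‖G z₁ - G s₀‖ with hm
  have hm0 : 0 < m := norm_pos_iff.2 (sub_ne_zero.2
    ((hrsub (sphere_subset_closedBall hz₁)).1 (ne_of_mem_sphere hz₁ hr.ne')))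
  refine ⟨r, hr, hrU, m / 5, by positivity, fun F hF hFG => ?_⟩
  have h0 := hFG s₀ (mem_closedBall_self hr.le)
  have hsph : ∀ z ∈ sphere s₀ r, 3 * m / 5 ≤ ‖F z - F s₀‖ := by
    intro z hz
    have h1 := hFG z (sphere_subset_closedBall hz)
    have h2 : m ≤ ‖G z - G s₀‖ := hmin hz
    have h3 : G z - G s₀ = (F z - F s₀) - (F z - G z) + (F s₀ - G s₀) := by ring
    have h4 : ‖G z - G s₀‖ ≤ ‖F z - F s₀‖ + ‖F z - G z‖ + ‖F s₀ - G s₀‖ := by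
      rw [h3]; exact (norm_add_le _ _).trans (by gcongr; exact norm_sub_le _ _)
    linarith
  have hfreq : ∃ᶠ z in 𝓝 s₀, F z ≠ F s₀ := by
    intro hcon
    have hcon' : F =ᶠ[𝓝 s₀] fun _ => F s₀ := by
      filter_upwards [hcon] with z hz
      exact not_not.1 hz
    have := (hF.analyticOnNhd hU).eqOn_of_preconnected_of_eventuallyEq analyticOnNhd_const hU'
      hs₀ hcon' (hrU (sphere_subset_closedBall hz₁))
    have h5 := hsph z₁ hz₁
    rw [this, sub_self, norm_zero] at h5
    linarith
  have hdc : DiffContOnCl ℂ F (ball s₀ r) :=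
    (hF.mono (closure_ball_subset_closedBall.trans hrU)).diffContOnCl
  have hmem : G s₀ ∈ ball (F s₀) (3 * m / 5 / 2) := by
    rw [mem_ball, dist_comm, dist_eq_norm]; linarith
  obtain ⟨s, hs, hs'⟩ := hdc.ball_subset_image_closedBall hr hsph hfreq hmem
  exact ⟨s, hs, hs'⟩

/-! ### The logarithm of `ζ(2s) / ζ(3s)` and its twists -/

/-- The logarithm of the Euler factor of `ζ(2s) / ζ(3s)`, as a function of `z = p ^ (-s)`. -/
noncomputable def logFactor (z : ℂ) : ℂ := Complex.log (1 - z ^ 3) - Complex.log (1 - z ^ 2)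

theorem one_sub_mem_slitPlane {w : ℂ} (hw : ‖w‖ < 1) : 1 - w ∈ Complex.slitPlane := by
  refine Or.inl ?_
  have := (Complex.re_le_norm w).trans_lt hw
  simp only [Complex.sub_re, Complex.one_re]; linarith

theorem differentiableAt_logFactor {z : ℂ} (hz : ‖z‖ < 1) : DifferentiableAt ℂ logFactor z := by
  have h : ∀ n : ℕ, n ≠ 0 → ‖z ^ n‖ < 1 := fun n hn => by
    rw [norm_pow]; exact pow_lt_one₀ (norm_nonneg _) hz hn
  have hlog : ∀ n : ℕ, n ≠ 0 → DifferentiableAt ℂ (fun z : ℂ => Complex.log (1 - z ^ n)) z :=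
    fun n hn => DifferentiableAt.clog (by fun_prop) (one_sub_mem_slitPlane (h n hn))
  exact (hlog 3 (by norm_num)).sub (hlog 2 (by norm_num))

theorem norm_logFactor_le {z : ℂ} (hz : ‖z‖ ≤ 1 / 2) : ‖logFactor z‖ ≤ 3 * ‖z‖ ^ 2 := by
  have h2 : ‖-z ^ 2‖ ≤ 1 / 2 := by
    rw [norm_neg, norm_pow]; nlinarith [norm_nonneg z]
  have h3 : ‖-z ^ 3‖ ≤ ‖z‖ ^ 2 := by
    rw [norm_neg, norm_pow, pow_succ]; nlinarith [norm_nonneg z, sq_nonneg ‖z‖]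
  have h3' : ‖-z ^ 3‖ ≤ 1 / 2 := h3.trans (by simpa using h2)
  have e2 := Complex.norm_log_one_add_half_le_self h2
  have e3 := Complex.norm_log_one_add_half_le_self h3'
  rw [← sub_eq_add_neg] at e2 e3
  refine (norm_sub_le _ _).trans ?_
  rw [norm_neg, norm_pow] at e2
  linarith

theorem norm_prime_cpow_neg (p : Nat.Primes) (s : ℂ) :
    ‖((p : ℕ) : ℂ) ^ (-s)‖ = ((p : ℕ) : ℝ) ^ (-s.re) := by
  rw [Complex.norm_natCast_cpow_of_pos p.2.pos, Complex.neg_re]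

theorem norm_prime_cpow_neg_le (p : Nat.Primes) {s : ℂ} (hs : 1 ≤ s.re) :
    ‖((p : ℕ) : ℂ) ^ (-s)‖ ≤ ((p : ℕ) : ℝ)⁻¹ := by
  rw [norm_prime_cpow_neg, ← Real.rpow_neg_one]
  exact Real.rpow_le_rpow_of_exponent_le (by exact_mod_cast p.2.one_le) (by linarith)

theorem prime_inv_le_half (p : Nat.Primes) : ((p : ℕ) : ℝ)⁻¹ ≤ 1 / 2 := by
  rw [one_div]
  exact inv_anti₀ two_pos (by exact_mod_cast p.2.two_le)

theorem summable_prime_inv_sq : Summable fun p : Nat.Primes => 3 * (((p : ℕ) : ℝ)⁻¹) ^ 2 := by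
  refine Summable.mul_left _ ?_
  have := Nat.Primes.summable_rpow.2 (show (-2 : ℝ) < -1 by norm_num)
  refine this.congr fun p => ?_
  rw [Real.rpow_neg (by positivity), inv_pow]
  norm_cast

theorem norm_logFactor_le_inv_sq (p : Nat.Primes) {z : ℂ} (hz : ‖z‖ ≤ ((p : ℕ) : ℝ)⁻¹) :
    ‖logFactor z‖ ≤ 3 * (((p : ℕ) : ℝ)⁻¹) ^ 2 := by
  refine (norm_logFactor_le (hz.trans (prime_inv_le_half p))).trans ?_
  gcongr

/-- The logarithm of `ζ(2s) / ζ(3s)` with each `p ^ (-s)` multiplied by the phase `χ p`. -/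
noncomputable def twistedLog (χ : Nat.Primes → Circle) (s : ℂ) : ℂ :=
  ∑' p : Nat.Primes, logFactor (χ p * ((p : ℕ) : ℂ) ^ (-s))

theorem norm_circle_mul_cpow (c : Circle) (p : Nat.Primes) (s : ℂ) :
    ‖(c : ℂ) * ((p : ℕ) : ℂ) ^ (-s)‖ = ((p : ℕ) : ℝ) ^ (-s.re) := by
  rw [norm_mul, Circle.norm_coe, one_mul, norm_prime_cpow_neg]

theorem norm_circle_mul_cpow_le (c : Circle) (p : Nat.Primes) {s : ℂ} (hs : 1 ≤ s.re) :
    ‖(c : ℂ) * ((p : ℕ) : ℂ) ^ (-s)‖ ≤ ((p : ℕ) : ℝ)⁻¹ := by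
  rw [norm_mul, Circle.norm_coe, one_mul]
  exact norm_prime_cpow_neg_le p hs

theorem differentiableOn_twistedLog (χ : Nat.Primes → Circle) :
    DifferentiableOn ℂ (twistedLog χ) {s | 1 < s.re} := by
  refine Complex.differentiableOn_tsum_of_summable_norm summable_prime_inv_sq (fun p s hs => ?_)
    (isOpen_lt continuous_const Complex.continuous_re)
    (fun p s hs => norm_logFactor_le_inv_sq p (norm_circle_mul_cpow_le _ p (le_of_lt hs)))
  have h1 : ‖(χ p : ℂ) * ((p : ℕ) : ℂ) ^ (-s)‖ < 1 :=
    ((norm_circle_mul_cpow_le _ p (le_of_lt hs)).trans (prime_inv_le_half p)).trans_lt (by norm_num)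
  refine DifferentiableAt.differentiableWithinAt ?_
  have h2 : DifferentiableAt ℂ (fun s : ℂ => ((p : ℕ) : ℂ) ^ (-s)) s :=
    DifferentiableAt.const_cpow (by fun_prop) (Or.inl (by exact_mod_cast p.2.ne_zero))
  exact (differentiableAt_logFactor h1).comp s (h2.const_mul (χ p : ℂ))

theorem continuousOn_twistedLog_uncurry :
    ContinuousOn (fun x : (Nat.Primes → Circle) × ℂ => twistedLog x.1 x.2) {x | 1 < x.2.re} := by
  refine continuousOn_tsum (fun p x hx => ?_) summable_prime_inv_sq
    (fun p x hx => norm_logFactor_le_inv_sq p (norm_circle_mul_cpow_le _ p (le_of_lt hx)))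
  have h1 : ‖(x.1 p : ℂ) * ((p : ℕ) : ℂ) ^ (-x.2)‖ < 1 :=
    ((norm_circle_mul_cpow_le _ p (le_of_lt hx)).trans (prime_inv_le_half p)).trans_lt (by norm_num)
  refine ContinuousAt.continuousWithinAt ?_
  refine ContinuousAt.comp (f := fun x : (Nat.Primes → Circle) × ℂ =>
    (x.1 p : ℂ) * ((p : ℕ) : ℂ) ^ (-x.2)) (differentiableAt_logFactor h1).continuousAt ?_
  refine ContinuousAt.mul (by fun_prop) ?_
  exact ContinuousAt.const_cpow (by fun_prop) (Or.inl (by exact_mod_cast p.2.ne_zero))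

open Filter Topology in
/-- The twisted logarithm depends continuously on the phases, uniformly on compact sets. -/
theorem eventually_forall_norm_twistedLog_sub_lt (χ : Nat.Primes → Circle) {K : Set ℂ}
    (hK : IsCompact K) (hK' : ∀ s ∈ K, 1 < s.re) {ε : ℝ} (hε : 0 < ε) :
    ∀ᶠ χ' in 𝓝 χ, ∀ s ∈ K, ‖twistedLog χ' s - twistedLog χ s‖ < ε := by
  refine hK.eventually_forall_of_forall_eventually fun s hs => ?_
  have hopen : IsOpen {x : (Nat.Primes → Circle) × ℂ | 1 < x.2.re} :=
    isOpen_lt continuous_const (Complex.continuous_re.comp continuous_snd)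
  have h1 : ContinuousAt (fun x : (Nat.Primes → Circle) × ℂ => twistedLog x.1 x.2) (χ, s) :=
    continuousOn_twistedLog_uncurry.continuousAt (hopen.mem_nhds (hK' s hs))
  have h2 : ContinuousAt (fun x : (Nat.Primes → Circle) × ℂ => twistedLog χ x.2) (χ, s) := by
    have h : ContinuousAt (fun x : (Nat.Primes → Circle) × ℂ => (χ, x.2)) (χ, s) :=
      (continuous_const.prodMk continuous_snd).continuousAt
    exact ContinuousAt.comp (f := fun x : (Nat.Primes → Circle) × ℂ => (χ, x.2)) h1 h
  have h3 : Tendsto (fun x : (Nat.Primes → Circle) × ℂ => ‖twistedLog x.1 x.2 - twistedLog χ x.2‖)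
      (𝓝 (χ, s)) (𝓝 0) := by
    have h := (h1.sub h2).norm.tendsto
    simpa only [Pi.sub_apply, sub_self, norm_zero] using h
  exact h3.eventually_lt_const hε

/-- Phases `p ^ (-i T)` amount to a vertical shift by `T`. -/
theorem twistedLog_exp_neg_log (T : ℝ) (s : ℂ) :
    twistedLog (fun p : Nat.Primes => Circle.exp (-(T * Real.log p))) s
      = twistedLog 1 (s + T * Complex.I) := by
  refine tsum_congr fun p => ?_
  have hp : ((p : ℕ) : ℂ) ≠ 0 := by exact_mod_cast p.2.ne_zero
  congr 1
  rw [Circle.coe_exp, Pi.one_apply, Circle.coe_one, one_mul, Complex.cpow_def_of_ne_zero hp,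
    Complex.cpow_def_of_ne_zero hp, ← Complex.exp_add]
  congr 1
  rw [Complex.natCast_log.symm]
  push_cast; ring

/-- `ζ(2s) / ζ(3s)` is the exponential of the untwisted logarithm. -/
theorem riemannZeta_two_mul_eq {s : ℂ} (hs : 1 < s.re) :
    riemannZeta (2 * s) = Complex.exp (twistedLog 1 s) * riemannZeta (3 * s) := by
  have hre : ∀ n : ℕ, 1 ≤ n → 1 < ((n : ℂ) * s).re := fun n hn => by
    have : (1 : ℝ) ≤ n := by exact_mod_cast hn
    simp only [Complex.mul_re, Complex.natCast_re, Complex.natCast_im, zero_mul, sub_zero]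
    nlinarith
  have hpow : ∀ (n : ℕ) (p : Nat.Primes),
      ((p : ℕ) : ℂ) ^ (-((n : ℂ) * s)) = (((p : ℕ) : ℂ) ^ (-s)) ^ n := fun n p => by
    rw [← Complex.cpow_nat_mul]; congr 1; ring
  have hsum : ∀ n : ℕ, 2 ≤ n → Summable fun p : Nat.Primes =>
      -Complex.log (1 - ((p : ℕ) : ℂ) ^ (-((n : ℂ) * s))) := by
    intro n hn
    refine Summable.of_norm_bounded summable_prime_inv_sq fun p => ?_
    have h1 := (norm_prime_cpow_neg_le p hs.le)
    have h2 := prime_inv_le_half p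
    have h3 : ‖-((p : ℕ) : ℂ) ^ (-((n : ℂ) * s))‖ ≤ (((p : ℕ) : ℝ)⁻¹) ^ 2 := by
      rw [norm_neg, hpow, norm_pow]
      refine (pow_le_pow_left₀ (norm_nonneg _) h1 n).trans ?_
      exact pow_le_pow_of_le_one (by positivity) (by linarith) hn
    have h4 : (((p : ℕ) : ℝ)⁻¹) ^ 2 ≤ 1 / 2 := by
      have : 0 ≤ ((p : ℕ) : ℝ)⁻¹ := by positivity
      nlinarith
    have h5 := Complex.norm_log_one_add_half_le_self (h3.trans h4)
    rw [← sub_eq_add_neg] at h5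
    rw [norm_neg]
    nlinarith
  have e2 := riemannZeta_eulerProduct_exp_log (hre 2 (by norm_num))
  have e3 := riemannZeta_eulerProduct_exp_log (hre 3 (by norm_num))
  push_cast at e2 e3
  rw [← e2, ← e3, ← Complex.exp_add]
  congr 1
  have s2 := hsum 2 le_rfl
  have s3 := hsum 3 (by norm_num)
  push_cast at s2 s3
  rw [twistedLog, ← sub_eq_iff_eq_add, ← s2.tsum_sub s3]
  refine tsum_congr fun p => ?_
  have h2 := hpow 2 p
  have h3 := hpow 3 p
  push_cast at h2 h3
  rw [h2, h3, logFactor]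
  simp only [Pi.one_apply, Circle.coe_one, one_mul]
  ring

theorem riemannZeta_pow_add_pow_eq_zero_iff {s : ℂ} (hs : 1 < s.re) (k : ℕ) :
    riemannZeta (2 * s) ^ k + riemannZeta (3 * s) ^ k = 0 ↔
      Complex.exp (k * twistedLog 1 s) = -1 := by
  have h3 : riemannZeta (3 * s) ≠ 0 := riemannZeta_ne_zero_of_one_lt_re (by simp; linarith)
  rw [riemannZeta_two_mul_eq hs, mul_pow, ← Complex.exp_nat_mul, eq_neg_iff_add_eq_zero,
    show ∀ a b : ℂ, a * b + b = (a + 1) * b by intros; ring, mul_eq_zero,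
    or_iff_left (pow_ne_zero k h3)]

open Filter Topology in
theorem tendsto_twistedLog_atTop (χ : Nat.Primes → Circle) :
    Tendsto (fun σ : ℝ => twistedLog χ σ) atTop (𝓝 0) := by
  have h0 : ∑' _ : Nat.Primes, (0 : ℂ) = 0 := tsum_zero
  rw [← h0]
  refine tendsto_tsum_of_dominated_convergence summable_prime_inv_sq (fun p => ?_) ?_
  · have hz : Tendsto (fun σ : ℝ => (χ p : ℂ) * ((p : ℕ) : ℂ) ^ (-(σ : ℂ))) atTop (𝓝 0) := by
      rw [tendsto_zero_iff_norm_tendsto_zero]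
      simp_rw [norm_circle_mul_cpow, Complex.ofReal_re]
      have hp : (1 : ℝ) < ((p : ℕ) : ℝ) := by exact_mod_cast p.2.one_lt
      exact (tendsto_rpow_atBot_of_base_gt_one _ hp).comp
        tendsto_neg_atTop_atBot
    have := (differentiableAt_logFactor (z := 0) (by simp)).continuousAt.tendsto.comp hz
    simpa [logFactor, Function.comp_def] using this
  · filter_upwards [eventually_ge_atTop 1] with σ hσ p
    exact norm_logFactor_le_inv_sq p (norm_circle_mul_cpow_le _ p (by simpa using hσ))

/-- A value `v ≠ 0` of a twisted logarithm at some point of `1 < re s` is a value of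
`log (ζ(2s) / ζ(3s))` at infinitely many points: by Kronecker's theorem vertical shifts approximate
the twist, and approximants of a nonconstant function still attain `v`. -/
theorem infinite_setOf_twistedLog_eq (χ : Nat.Primes → Circle) {s₀ v : ℂ} (hs₀ : 1 < s₀.re)
    (hv : v ≠ 0) (h : twistedLog χ s₀ = v) : {s : ℂ | 1 < s.re ∧ twistedLog 1 s = v}.Infinite := by
  have hU : IsOpen {s : ℂ | 1 < s.re} := isOpen_lt continuous_const Complex.continuous_re
  have hU' : IsPreconnected {s : ℂ | 1 < s.re} := (convex_halfSpace_re_gt 1).isPreconnected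
  obtain ⟨s₁, hs₁, hne⟩ : ∃ s₁ : ℂ, 1 < s₁.re ∧ twistedLog χ s₁ ≠ twistedLog χ s₀ := by
    have := (tendsto_twistedLog_atTop χ).eventually_ne hv.symm
    obtain ⟨σ, h1, h2⟩ := (this.and (Filter.eventually_gt_atTop 1)).exists
    exact ⟨σ, by simpa using h2, by rwa [h]⟩
  obtain ⟨r, hr, hrU, ε, hε, hF⟩ := exists_ball_forall_near_exists_eq hU hU'
    (differentiableOn_twistedLog χ) hs₀ hs₁ hne
  have hnear := eventually_forall_norm_twistedLog_sub_lt χ (isCompact_closedBall s₀ r)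
    (fun s hs => hrU hs) hε
  refine Set.Infinite.of_image Complex.im (Set.infinite_of_not_bddAbove ?_)
  rintro ⟨M, hM⟩
  obtain ⟨T, hT, hTU⟩ := exists_circle_exp_neg_log_mem χ hnear (M + r + 1 - s₀.im)
  obtain ⟨s, hs, hsv⟩ := hF _ (differentiableOn_twistedLog _) hTU
  rw [twistedLog_exp_neg_log, h] at hsv
  have hre : 1 < (s + T * Complex.I).re := by simpa using hrU hs
  have him := hM ⟨s + T * Complex.I, ⟨hre, hsv⟩, rfl⟩
  have h1 : |(s - s₀).im| ≤ r := (Complex.abs_im_le_norm _).trans (by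
    simpa [dist_eq_norm] using hs)
  have h2 := (abs_le.1 h1).1
  simp only [Complex.add_im, Complex.mul_im, Complex.ofReal_re, Complex.I_im, mul_one,
    Complex.ofReal_im, Complex.I_re, mul_zero, add_zero, Complex.sub_im] at him h2
  linarith

/-! ### Real and imaginary parts of an Euler factor -/

theorem one_sub_pow_ne_zero {z : ℂ} (hz : ‖z‖ < 1) {n : ℕ} (hn : n ≠ 0) : 1 - z ^ n ≠ 0 :=
  Complex.slitPlane_ne_zero (one_sub_mem_slitPlane (by
    rw [norm_pow]; exact pow_lt_one₀ (norm_nonneg _) hz hn))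

theorem one_add_ne_zero {z : ℂ} (hz : ‖z‖ < 1) : 1 + z ≠ 0 := by
  have := one_sub_pow_ne_zero (z := -z) (by rwa [norm_neg]) one_ne_zero
  simpa using this

theorem exp_logFactor_mul {z : ℂ} (hz : ‖z‖ < 1) :
    Complex.exp (logFactor z) * (1 + z) = 1 + z + z ^ 2 := by
  have h2 := one_sub_pow_ne_zero hz two_ne_zero
  have h3 := one_sub_pow_ne_zero hz three_ne_zero
  have h1 : 1 - z ≠ 0 := by simpa using one_sub_pow_ne_zero hz one_ne_zero
  rw [logFactor, Complex.exp_sub, Complex.exp_log h3, Complex.exp_log h2, div_mul_eq_mul_div,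
    div_eq_iff h2]
  ring

/-- The Euler factor cleared of its denominator, so that its real and imaginary parts become
polynomials. -/
theorem exp_logFactor_mul_normSq {z : ℂ} (hz : ‖z‖ < 1) :
    Complex.exp (logFactor z) * (Complex.normSq (1 + z) : ℂ)
      = (1 + z + z ^ 2) * (starRingEnd ℂ) (1 + z) := by
  rw [← exp_logFactor_mul hz, Complex.normSq_eq_conj_mul_self]; ring

theorem exp_logFactor_re_mul_normSq {z : ℂ} (hz : ‖z‖ < 1) :
    (Complex.exp (logFactor z)).re * Complex.normSq (1 + z)
      = 1 + 2 * z.re + 2 * z.re ^ 2 + ‖z‖ ^ 2 * z.re := by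
  have h := congrArg Complex.re (exp_logFactor_mul_normSq hz)
  rw [Complex.re_mul_ofReal] at h
  rw [h, Complex.sq_norm, Complex.normSq_apply]
  simp [pow_two]
  ring

theorem exp_logFactor_im_mul_normSq {z : ℂ} (hz : ‖z‖ < 1) :
    (Complex.exp (logFactor z)).im * Complex.normSq (1 + z) = z.im * (2 * z.re + ‖z‖ ^ 2) := by
  have h := congrArg Complex.im (exp_logFactor_mul_normSq hz)
  rw [Complex.im_mul_ofReal] at h
  rw [h, Complex.sq_norm, Complex.normSq_apply]
  simp [pow_two]
  ring

theorem abs_logFactor_im_lt_pi {z : ℂ} (hz : ‖z‖ < 1) : |(logFactor z).im| < Real.pi := by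
  have h : ∀ n : ℕ, n ≠ 0 → |(Complex.log (1 - z ^ n)).im| < Real.pi / 2 := fun n hn => by
    rw [Complex.log_im, Complex.abs_arg_lt_pi_div_two_iff]
    left
    have h1 : ‖z ^ n‖ < 1 := by rw [norm_pow]; exact pow_lt_one₀ (norm_nonneg _) hz hn
    have := (Complex.re_le_norm (z ^ n)).trans_lt h1
    simp only [Complex.sub_re, Complex.one_re]; linarith
  rw [logFactor, Complex.sub_im]
  have h2 := h 2 two_ne_zero
  have h3 := h 3 three_ne_zero
  refine (abs_sub _ _).trans_lt ?_
  linarith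

/-! ### Phases making every Euler factor purely imaginary -/

/-- The cosine `c` of an argument for which `z = r e ^ (iα)` satisfies `|1 + z + z ^ 2| = |1 + z|`,
that is, `4 c ^ 2 + 2 r c + r ^ 2 - 2 = 0`. The negative root gives the larger argument of the
Euler factor. -/
noncomputable def balancedCos (r : ℝ) : ℝ := -(r + Real.sqrt (8 - 3 * r ^ 2)) / 4

/-- The unimodular number with real part `balancedCos r` in the lower half-plane. -/
noncomputable def balancedPhase (r : ℝ) : Circle := Circle.exp (-Real.arccos (balancedCos r))

theorem continuous_balancedPhase : Continuous balancedPhase := by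
  unfold balancedPhase balancedCos
  exact Circle.exp.continuous.comp (Real.continuous_arccos.comp (by fun_prop)).neg

theorem balancedCos_equation {r : ℝ} (h0 : 0 ≤ r) (h1 : r ≤ 1 / 2) :
    4 * balancedCos r ^ 2 + 2 * r * balancedCos r + r ^ 2 - 2 = 0 := by
  have := Real.sq_sqrt (show 0 ≤ 8 - 3 * r ^ 2 by nlinarith)
  unfold balancedCos
  nlinarith

theorem balancedCos_sq_le_one {r : ℝ} (h0 : 0 ≤ r) (h1 : r ≤ 1 / 2) : balancedCos r ^ 2 ≤ 1 := by
  have := Real.sq_sqrt (show 0 ≤ 8 - 3 * r ^ 2 by nlinarith)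
  unfold balancedCos
  nlinarith [sq_nonneg (r - Real.sqrt (8 - 3 * r ^ 2))]

theorem two_mul_balancedCos_add_nonpos {r : ℝ} (h0 : 0 ≤ r) (h1 : r ≤ 1 / 2) :
    2 * balancedCos r + r ≤ 0 := by
  have : r ≤ Real.sqrt (8 - 3 * r ^ 2) := Real.le_sqrt_of_sq_le (by nlinarith)
  unfold balancedCos
  linarith

theorem balancedPhase_re {r : ℝ} (h0 : 0 ≤ r) (h1 : r ≤ 1 / 2) :
    (balancedPhase r : ℂ).re = balancedCos r := by
  have h := (sq_le_one_iff_abs_le_one _).1 (balancedCos_sq_le_one h0 h1)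
  rw [balancedPhase, Circle.coe_exp, Complex.exp_ofReal_mul_I_re, Real.cos_neg,
    Real.cos_arccos (abs_le.1 h).1 (abs_le.1 h).2]

theorem balancedPhase_im_nonpos (r : ℝ) : (balancedPhase r : ℂ).im ≤ 0 := by
  rw [balancedPhase, Circle.coe_exp, Complex.exp_ofReal_mul_I_im, Real.sin_neg, Real.sin_arccos]
  exact neg_nonpos.2 (Real.sqrt_nonneg _)

theorem norm_balancedPhase_mul {r : ℝ} (h0 : 0 ≤ r) : ‖(balancedPhase r : ℂ) * r‖ = r := by
  rw [norm_mul, Circle.norm_coe, one_mul, Complex.norm_real, Real.norm_of_nonneg h0]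

theorem normSq_one_add_balancedPhase_mul {r : ℝ} (h0 : 0 ≤ r) (h1 : r ≤ 1 / 2) :
    Complex.normSq (1 + (balancedPhase r : ℂ) * r) = 1 + 2 * (r * balancedCos r) + r ^ 2 := by
  have hn := norm_balancedPhase_mul h0
  have hn2 : Complex.normSq ((balancedPhase r : ℂ) * r) = r ^ 2 := by
    rw [Complex.normSq_eq_norm_sq, hn]
  rw [Complex.normSq_add, hn2, Complex.normSq_one, one_mul, Complex.conj_re, Complex.re_mul_ofReal,
    balancedPhase_re h0 h1]
  ring

/-- Balanced phases make the Euler factor unimodular. -/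
theorem logFactor_balanced_re {r : ℝ} (h0 : 0 ≤ r) (h1 : r ≤ 1 / 2) :
    (logFactor ((balancedPhase r : ℂ) * r)).re = 0 := by
  set z := (balancedPhase r : ℂ) * r with hz
  have hn : ‖z‖ = r := norm_balancedPhase_mul h0
  have hz1 : ‖z‖ < 1 := by rw [hn]; linarith
  have hre : z.re = r * balancedCos r := by
    rw [hz, Complex.re_mul_ofReal, balancedPhase_re h0 h1, mul_comm]
  have hN : Complex.normSq (1 + z) ≠ 0 := by
    simpa [Complex.normSq_eq_zero] using one_add_ne_zero hz1
  have e1 := exp_logFactor_re_mul_normSq hz1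
  have e2 := exp_logFactor_im_mul_normSq hz1
  have hy : z.im ^ 2 = r ^ 2 - z.re ^ 2 := by
    rw [← hn, Complex.sq_norm, Complex.normSq_apply]; ring
  have hNv : Complex.normSq (1 + z) = 1 + 2 * z.re + r ^ 2 := by
    rw [hz, normSq_one_add_balancedPhase_mul h0 h1, ← hz, hre]
  have hc := balancedCos_equation h0 h1
  have hc' : 4 * z.re ^ 2 + 2 * r ^ 2 * z.re + r ^ 4 - 2 * r ^ 2 = 0 := by
    rw [hre]; linear_combination r ^ 2 * hc
  have hsq : Complex.normSq (Complex.exp (logFactor z)) * Complex.normSq (1 + z) ^ 2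
      = Complex.normSq (1 + z) ^ 2 := by
    rw [Complex.normSq_apply]
    have : ((Complex.exp (logFactor z)).re * (Complex.exp (logFactor z)).re
        + (Complex.exp (logFactor z)).im * (Complex.exp (logFactor z)).im)
          * Complex.normSq (1 + z) ^ 2
        = ((Complex.exp (logFactor z)).re * Complex.normSq (1 + z)) ^ 2
          + ((Complex.exp (logFactor z)).im * Complex.normSq (1 + z)) ^ 2 := by ring
    rw [this, e1, e2, hn, mul_pow, hy, hNv]
    linear_combination (1 + 2 * z.re + r ^ 2) * hc'
  have hone : Complex.normSq (Complex.exp (logFactor z)) = 1 :=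
    mul_right_cancel₀ (pow_ne_zero 2 hN) (by rw [hsq, one_mul])
  rw [Complex.normSq_eq_norm_sq, Complex.norm_exp, ← Real.exp_nat_mul, Real.exp_eq_one_iff] at hone
  simpa using hone

theorem exp_logFactor_balanced {r : ℝ} (h0 : 0 ≤ r) (h1 : r ≤ 1 / 2) :
    Complex.exp (logFactor ((balancedPhase r : ℂ) * r))
      = Complex.exp (Complex.I * (logFactor ((balancedPhase r : ℂ) * r)).im) := by
  congr 1
  apply Complex.ext <;> simp [logFactor_balanced_re h0 h1]

theorem logFactor_balanced_im_nonneg {r : ℝ} (h0 : 0 ≤ r) (h1 : r ≤ 1 / 2) :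
    0 ≤ (logFactor ((balancedPhase r : ℂ) * r)).im := by
  set z := (balancedPhase r : ℂ) * r with hz
  have hn : ‖z‖ = r := norm_balancedPhase_mul h0
  have hz1 : ‖z‖ < 1 := by rw [hn]; linarith
  have hN : 0 < Complex.normSq (1 + z) := Complex.normSq_pos.2 (one_add_ne_zero hz1)
  have e2 := exp_logFactor_im_mul_normSq hz1
  by_contra! hneg
  have hpi := (abs_lt.1 (abs_logFactor_im_lt_pi hz1)).1
  have hsin := Real.sin_neg_of_neg_of_neg_pi_lt hneg hpi
  have him : (Complex.exp (logFactor z)).im < 0 := by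
    rw [Complex.exp_im]
    exact mul_neg_of_pos_of_neg (Real.exp_pos _) hsin
  have h2 : z.im * (2 * z.re + ‖z‖ ^ 2) < 0 := by
    rw [← e2]; exact mul_neg_of_neg_of_pos him hN
  have hzim : z.im ≤ 0 := by
    rw [hz, Complex.im_mul_ofReal]
    exact mul_nonpos_of_nonpos_of_nonneg (balancedPhase_im_nonpos r) h0
  have hzre : 2 * z.re + ‖z‖ ^ 2 ≤ 0 := by
    rw [hn, hz, Complex.re_mul_ofReal, balancedPhase_re h0 h1]
    have := two_mul_balancedCos_add_nonpos h0 h1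
    nlinarith
  nlinarith

/-- The balanced Euler factor of the prime `2` at `σ = 1` alone has argument at least
`7 / 20 > π / 9`: it is `e ^ (iθ)` with `θ ≥ |e ^ (iθ) - 1| = |z ^ 2 / (1 + z)|`. -/
theorem le_logFactor_balanced_half_im :
    7 / 20 ≤ (logFactor ((balancedPhase (1 / 2) : ℂ) * ((1 / 2 : ℝ) : ℂ))).im := by
  have h0 : (0 : ℝ) ≤ 1 / 2 := by norm_num
  have h1 : (1 / 2 : ℝ) ≤ 1 / 2 := le_rfl
  have hexp := exp_logFactor_balanced h0 h1
  have hpos := logFactor_balanced_im_nonneg h0 h1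
  have hN := normSq_one_add_balancedPhase_mul h0 h1
  have hn := norm_balancedPhase_mul h0
  set z := (balancedPhase (1 / 2) : ℂ) * ((1 / 2 : ℝ) : ℂ) with hz
  have hE := exp_logFactor_mul (z := z) (by rw [hn]; norm_num)
  have hE' : (Complex.exp (logFactor z) - 1) * (1 + z) = z ^ 2 := by linear_combination hE
  have hle := Real.norm_exp_I_mul_ofReal_sub_one_le (x := (logFactor z).im)
  rw [← hexp, Real.norm_of_nonneg hpos] at hle
  have hnorm : ‖Complex.exp (logFactor z) - 1‖ * ‖1 + z‖ = 1 / 4 := by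
    rw [← norm_mul, hE', norm_pow, hn]; norm_num
  have hc : balancedCos (1 / 2) ≤ -3 / 4 := by
    have : 5 / 2 ≤ Real.sqrt (8 - 3 * (1 / 2) ^ 2) := Real.le_sqrt_of_sq_le (by norm_num)
    unfold balancedCos
    linarith
  have hz7 : ‖1 + z‖ ≤ 5 / 7 := by
    refine abs_le_of_sq_le_sq' ?_ (by norm_num) |>.2
    rw [Complex.sq_norm, hN]; linarith
  have := norm_nonneg (1 + z)
  nlinarith

theorem prime_cpow_neg_ofReal (p : Nat.Primes) (σ : ℝ) :
    ((p : ℕ) : ℂ) ^ (-(σ : ℂ)) = ((((p : ℕ) : ℝ) ^ (-σ) : ℝ) : ℂ) := by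
  rw [Complex.ofReal_cpow (by positivity)]
  push_cast; rfl

theorem prime_rpow_neg_nonneg (p : Nat.Primes) (σ : ℝ) : 0 ≤ ((p : ℕ) : ℝ) ^ (-σ) :=
  Real.rpow_nonneg (by positivity) _

theorem prime_rpow_neg_le (p : Nat.Primes) {σ : ℝ} (hσ : 1 ≤ σ) :
    ((p : ℕ) : ℝ) ^ (-σ) ≤ ((p : ℕ) : ℝ)⁻¹ := by
  rw [← Real.rpow_neg_one]
  exact Real.rpow_le_rpow_of_exponent_le (by exact_mod_cast p.2.one_le) (by linarith)

theorem norm_logFactor_balanced_le (p : Nat.Primes) {σ : ℝ} (hσ : 1 ≤ σ) :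
    ‖logFactor ((balancedPhase (((p : ℕ) : ℝ) ^ (-σ)) : ℂ) * ((((p : ℕ) : ℝ) ^ (-σ) : ℝ) : ℂ))‖
      ≤ 3 * (((p : ℕ) : ℝ)⁻¹) ^ 2 := by
  have h := prime_rpow_neg_le p hσ
  refine norm_logFactor_le_inv_sq p ?_
  rwa [norm_balancedPhase_mul (prime_rpow_neg_nonneg p σ)]

open Filter Topology in
/-- Every `v` in `(0, 7 / 20)` is the imaginary part of a purely imaginary value of a twisted
logarithm on the real half-line `σ > 1`. With the phases balanced at abscissa `σ`, the imaginary
part is continuous in `σ`, at least `7 / 20` at `σ = 1`, and tends to `0` at infinity. -/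
theorem exists_twistedLog_eq_mul_I {v : ℝ} (hv0 : 0 < v) (hv : v < 7 / 20) :
    ∃ (χ : Nat.Primes → Circle) (σ : ℝ), 1 < σ ∧ twistedLog χ σ = v * Complex.I := by
  set ψ : ℝ → ℂ := fun r => logFactor ((balancedPhase r : ℂ) * (r : ℂ)) with hψ
  have hψc : ∀ r, 0 ≤ r → r ≤ 1 / 2 → ContinuousAt ψ r := by
    intro r h0 h1
    have hz : ‖(balancedPhase r : ℂ) * (r : ℂ)‖ < 1 := by
      rw [norm_balancedPhase_mul h0]; linarith
    have h2 : Continuous fun r : ℝ => (balancedPhase r : ℂ) * (r : ℂ) :=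
      (continuous_subtype_val.comp continuous_balancedPhase).mul Complex.continuous_ofReal
    exact ContinuousAt.comp (f := fun r : ℝ => (balancedPhase r : ℂ) * (r : ℂ))
      (differentiableAt_logFactor hz).continuousAt h2.continuousAt
  have hrange : ∀ (p : Nat.Primes) {σ : ℝ}, 1 ≤ σ → ((p : ℕ) : ℝ) ^ (-σ) ≤ 1 / 2 := fun p σ hσ =>
    (prime_rpow_neg_le p hσ).trans (prime_inv_le_half p)
  have hbound : ∀ (p : Nat.Primes) {σ : ℝ}, 1 ≤ σ →
      ‖(ψ (((p : ℕ) : ℝ) ^ (-σ))).im‖ ≤ 3 * (((p : ℕ) : ℝ)⁻¹) ^ 2 := fun p σ hσ =>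
    (Complex.abs_im_le_norm _).trans (norm_logFactor_balanced_le p hσ)
  set S : ℝ → ℝ := fun σ => ∑' p : Nat.Primes, (ψ (((p : ℕ) : ℝ) ^ (-σ))).im with hS
  have hScont : ContinuousOn S (Set.Ici 1) := by
    refine continuousOn_tsum (fun p σ hσ => ?_) summable_prime_inv_sq fun p σ hσ => hbound p hσ
    have hp : ContinuousAt (fun σ : ℝ => ((p : ℕ) : ℝ) ^ (-σ)) σ :=
      ContinuousAt.rpow continuousAt_const continuousAt_neg
        (Or.inl (by exact_mod_cast p.2.ne_zero))
    exact (Complex.continuous_im.continuousAt.comp (ContinuousAt.comp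
      (f := fun σ : ℝ => ((p : ℕ) : ℝ) ^ (-σ))
      (hψc _ (prime_rpow_neg_nonneg p σ) (hrange p hσ)) hp)).continuousWithinAt
  have hS1 : 7 / 20 ≤ S 1 := by
    have hsum : Summable fun p : Nat.Primes => (ψ (((p : ℕ) : ℝ) ^ (-(1 : ℝ)))).im :=
      Summable.of_norm_bounded summable_prime_inv_sq fun p => hbound p le_rfl
    have h2 := hsum.le_tsum ⟨2, Nat.prime_two⟩ fun p _ =>
      logFactor_balanced_im_nonneg (prime_rpow_neg_nonneg p 1) (hrange p le_rfl)
    refine le_trans ?_ h2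
    have he : (((⟨2, Nat.prime_two⟩ : Nat.Primes) : ℕ) : ℝ) ^ (-(1 : ℝ)) = 1 / 2 := by
      rw [Real.rpow_neg_one]; norm_num
    rw [he]
    exact le_logFactor_balanced_half_im
  have hSlim : Tendsto S atTop (𝓝 0) := by
    have h0 : ∑' _ : Nat.Primes, (0 : ℝ) = 0 := tsum_zero
    rw [← h0]
    refine tendsto_tsum_of_dominated_convergence summable_prime_inv_sq (fun p => ?_) ?_
    · have hp : (1 : ℝ) < ((p : ℕ) : ℝ) := by exact_mod_cast p.2.one_lt
      have hr : Tendsto (fun σ : ℝ => ((p : ℕ) : ℝ) ^ (-σ)) atTop (𝓝 0) :=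
        (tendsto_rpow_atBot_of_base_gt_one _ hp).comp tendsto_neg_atTop_atBot
      have := (Complex.continuous_im.continuousAt.comp
        (hψc 0 le_rfl (by norm_num))).tendsto.comp hr
      simpa [hψ, logFactor, Function.comp_def] using this
    · filter_upwards [eventually_ge_atTop 1] with σ hσ p
      exact hbound p hσ
  obtain ⟨M, hM, hM1⟩ := ((hSlim.eventually_lt_const hv0).and (eventually_ge_atTop 1)).exists
  obtain ⟨σ, hσ, hσv⟩ := intermediate_value_Icc' hM1 (hScont.mono Set.Icc_subset_Ici_self)
    ⟨hM.le, hv.le.trans hS1⟩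
  have hσ1 : 1 < σ := lt_of_le_of_ne hσ.1 fun h => by
    rw [← h] at hσv; linarith
  refine ⟨fun p => balancedPhase (((p : ℕ) : ℝ) ^ (-σ)), σ, hσ1, ?_⟩
  rw [← hσv, hS, Complex.ofReal_tsum, ← tsum_mul_right, twistedLog]
  refine tsum_congr fun p => ?_
  rw [prime_cpow_neg_ofReal]
  apply Complex.ext
  · simp [logFactor_balanced_re (prime_rpow_neg_nonneg p σ) (hrange p hσ1.le)]
  · simp [hψ]

/-! ### Existence and absence of zeros -/

theorem infinite_setOf_zeros {k : ℕ} (hk : 9 ≤ k) :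
    {s : ℂ | 1 < s.re ∧ riemannZeta (2 * s) ^ k + riemannZeta (3 * s) ^ k = 0}.Infinite := by
  have hk0 : (0 : ℝ) < k := by exact_mod_cast (by omega : 0 < k)
  have hk9 : (9 : ℝ) ≤ k := by exact_mod_cast hk
  have hpi := Real.pi_lt_d2
  have hv0 : 0 < Real.pi / k := div_pos Real.pi_pos hk0
  have hv : Real.pi / k < 7 / 20 := by
    rw [div_lt_iff₀ hk0]; linarith
  obtain ⟨χ, σ, hσ, h⟩ := exists_twistedLog_eq_mul_I hv0 hv
  have hne : ((Real.pi / k : ℝ) : ℂ) * Complex.I ≠ 0 :=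
    mul_ne_zero (by exact_mod_cast hv0.ne') Complex.I_ne_zero
  refine (infinite_setOf_twistedLog_eq χ (by simpa using hσ) hne h).mono ?_
  rintro s ⟨hs, hsv⟩
  refine ⟨hs, (riemannZeta_pow_add_pow_eq_zero_iff hs k).2 ?_⟩
  have hkc : (k : ℂ) ≠ 0 := by exact_mod_cast hk0.ne'
  rw [hsv, ← Complex.exp_pi_mul_I]
  congr 1
  push_cast
  field_simp

/-! ### Bounds for the argument of an Euler factor -/

theorem arctan_le_self {x : ℝ} (hx : 0 ≤ x) : Real.arctan x ≤ x := by
  have h := Real.le_tan (Real.arctan_nonneg.2 hx) (Real.arctan_lt_pi_div_two x)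
  rwa [Real.tan_arctan] at h

theorem arctan_le_quintic {x : ℝ} (hx : 0 ≤ x) :
    Real.arctan x ≤ x - x ^ 3 / 3 + x ^ 5 / 5 := by
  set g : ℝ → ℝ := fun x => x - x ^ 3 / 3 + x ^ 5 / 5 - Real.arctan x with hg
  have hd : ∀ x, HasDerivAt g (1 - 3 * x ^ 2 / 3 + 5 * x ^ 4 / 5 - 1 / (1 + x ^ 2)) x := by
    intro x
    have h3 : HasDerivAt (fun x : ℝ => x ^ 3 / 3) (3 * x ^ 2 / 3) x := by
      simpa using (hasDerivAt_pow 3 x).div_const 3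
    have h5 : HasDerivAt (fun x : ℝ => x ^ 5 / 5) (5 * x ^ 4 / 5) x := by
      simpa using (hasDerivAt_pow 5 x).div_const 5
    exact (((hasDerivAt_id x).sub h3).add h5).sub (Real.hasDerivAt_arctan x)
  have hmono : Monotone g := monotone_of_deriv_nonneg (fun x => (hd x).differentiableAt) fun x => by
    rw [(hd x).deriv]
    have : 1 - 3 * x ^ 2 / 3 + 5 * x ^ 4 / 5 - 1 / (1 + x ^ 2) = x ^ 6 / (1 + x ^ 2) := by
      field_simp; ring
    rw [this]; positivity
  have := hmono hx
  simp only [hg, Real.arctan_zero] at this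
  norm_num at this
  linarith

theorem abs_logFactor_im_le_arctan {z : ℂ} (hz : ‖z‖ < 1) {τ : ℝ}
    (hre : 0 < (Complex.exp (logFactor z)).re)
    (him : |(Complex.exp (logFactor z)).im| ≤ τ * (Complex.exp (logFactor z)).re) :
    |(logFactor z).im| ≤ Real.arctan τ := by
  set θ := (logFactor z).im with hθ
  have hpi := abs_lt.1 (abs_logFactor_im_lt_pi hz)
  rw [Complex.exp_re, ← hθ] at hre him
  rw [Complex.exp_im, ← hθ] at him
  have hexp := Real.exp_pos (logFactor z).re
  have hcos : 0 < Real.cos θ := pos_of_mul_pos_right hre hexp.le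
  have hθ2 : |θ| < Real.pi / 2 := by
    by_contra! h
    have := Real.cos_nonpos_of_pi_div_two_le_of_le h (by
      have := abs_lt.2 hpi
      linarith [Real.pi_pos])
    rw [Real.cos_abs] at this
    linarith
  rw [abs_mul, abs_of_pos hexp] at him
  have hsin : |Real.sin θ| ≤ τ * Real.cos θ := by
    refine le_of_mul_le_mul_left ?_ hexp
    linarith
  have htan : Real.tan |θ| ≤ τ := by
    rw [Real.tan_eq_sin_div_cos, Real.cos_abs, div_le_iff₀ hcos]
    refine le_trans ?_ hsin
    rcases abs_choice θ with h | h <;> rw [h]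
    · exact le_abs_self _
    · rw [Real.sin_neg]; exact neg_le_abs _
  have h0 := abs_nonneg θ
  rw [← Real.arctan_tan (x := |θ|) (by linarith [Real.pi_pos]) hθ2]
  exact Real.arctan_mono htan

/-- The maximum principle for the harmonic function `im ∘ logFactor`, applied through the moduli of
`exp (± i logFactor)`. -/
theorem abs_logFactor_im_le_of_sphere {r θ : ℝ} (hr0 : 0 < r) (hr1 : r < 1)
    (h : ∀ w : ℂ, ‖w‖ = r → |(logFactor w).im| ≤ θ) {z : ℂ} (hz : ‖z‖ ≤ r) :
    |(logFactor z).im| ≤ θ := by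
  have key : ∀ c : ℝ, |c| = 1 → c * (logFactor z).im ≤ θ := by
    intro c hc
    have hnorm : ∀ w, ‖Complex.exp (-(c * Complex.I) * logFactor w)‖
        = Real.exp (c * (logFactor w).im) := fun w => by
      rw [Complex.norm_exp]; simp
    have hd : DiffContOnCl ℂ (fun w => Complex.exp (-(c * Complex.I) * logFactor w))
        (Metric.ball 0 r) := by
      refine DifferentiableOn.diffContOnCl fun w hw => ?_
      have hw' : ‖w‖ < 1 :=
        (mem_closedBall_zero_iff.1 (Metric.closure_ball_subset_closedBall hw)).trans_lt hr1
      exact ((differentiableAt_logFactor hw').const_mul _).cexp.differentiableWithinAt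
    have := Complex.norm_le_of_forall_mem_frontier_norm_le Metric.isBounded_ball hd
      (C := Real.exp θ) (fun w hw => by
        rw [frontier_ball _ hr0.ne', mem_sphere_zero_iff_norm] at hw
        rw [hnorm]
        refine Real.exp_le_exp.2 ((le_abs_self _).trans ?_)
        rw [abs_mul, hc, one_mul]
        exact h w hw) (z := z) (by
          rw [closure_ball _ hr0.ne']; exact mem_closedBall_zero_iff.2 hz)
    rw [hnorm] at this
    exact Real.exp_le_exp.1 this
  have h1 := key 1 (by simp)
  have h2 := key (-1) (by simp)
  exact abs_le.2 ⟨by linarith, by linarith⟩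

/-- On the circle `|z| = r` the tangent of the argument is
`y (2x + r²) / (1 + 2x + 2x² + r² x)` with `y² = r² - x²`, so a bound for it amounts to the
positivity of a quartic polynomial in `x`. -/
theorem abs_logFactor_im_le_of_quartic {r τ : ℝ} (hr0 : 0 < r) (hr1 : r < 1) (hτ : 0 ≤ τ)
    (hpos : ∀ x : ℝ, 0 < 1 + 2 * x + 2 * x ^ 2 + r ^ 2 * x)
    (hquartic : ∀ x : ℝ, (r ^ 2 - x ^ 2) * (2 * x + r ^ 2) ^ 2
      ≤ τ ^ 2 * (1 + 2 * x + 2 * x ^ 2 + r ^ 2 * x) ^ 2) {z : ℂ} (hz : ‖z‖ ≤ r) :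
    |(logFactor z).im| ≤ Real.arctan τ := by
  refine abs_logFactor_im_le_of_sphere hr0 hr1 (fun w hw => ?_) hz
  have hw1 : ‖w‖ < 1 := by rw [hw]; exact hr1
  have hN : 0 < Complex.normSq (1 + w) := Complex.normSq_pos.2 (one_add_ne_zero hw1)
  have e1 := exp_logFactor_re_mul_normSq hw1
  have e2 := exp_logFactor_im_mul_normSq hw1
  rw [hw] at e1 e2
  have hy : w.im ^ 2 = r ^ 2 - w.re ^ 2 := by
    rw [← hw, Complex.sq_norm, Complex.normSq_apply]; ring
  have hre : 0 < (Complex.exp (logFactor w)).re := by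
    refine pos_of_mul_pos_left ?_ hN.le
    rw [e1]; exact hpos _
  refine abs_logFactor_im_le_arctan hw1 hre ?_
  refine le_of_mul_le_mul_right ?_ hN
  have habs : |(Complex.exp (logFactor w)).im| * Complex.normSq (1 + w)
      = |w.im * (2 * w.re + r ^ 2)| := by
    rw [← e2, abs_mul, abs_of_pos hN]
  rw [mul_assoc, e1, habs]
  refine abs_le_of_sq_le_sq ?_ (mul_nonneg hτ (hpos _).le)
  rw [mul_pow, mul_pow, hy]
  exact hquartic _

/-- The square in the hints for the quartic is close to its double root: the constant `0.395` is
just above the largest tangent of the argument on the circle, which is about `0.3943`. -/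
theorem abs_logFactor_im_le_of_norm_le_half {z : ℂ} (hz : ‖z‖ ≤ 1 / 2) :
    |(logFactor z).im| ≤ 3764 / 10000 := by
  refine (abs_logFactor_im_le_of_quartic (τ := 395 / 1000) (by norm_num) (by norm_num)
    (by norm_num) (fun x => ?_) (fun x => ?_) hz).trans ?_
  · nlinarith [sq_nonneg (x + 9 / 16)]
  · nlinarith [sq_nonneg ((x + 41 / 100) * (x - 15 / 100)), sq_nonneg (x + 41 / 100), sq_nonneg x]
  · refine (arctan_le_quintic (by norm_num)).trans ?_
    norm_num

theorem abs_logFactor_im_le_of_norm_le_third {z : ℂ} (hz : ‖z‖ ≤ 1 / 3) :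
    |(logFactor z).im| ≤ 146 / 1000 := by
  refine (abs_logFactor_im_le_of_quartic (by norm_num) (by norm_num)
    (by norm_num) (fun x => ?_) (fun x => ?_) hz).trans (arctan_le_self (by norm_num))
  · nlinarith [sq_nonneg (x + 19 / 36)]
  · nlinarith [sq_nonneg ((x + 2658 / 10000) * (x - 189 / 1000)), sq_nonneg (x + 2658 / 10000),
      sq_nonneg x]

theorem abs_logFactor_im_le_of_norm_le_fifth {z : ℂ} (hz : ‖z‖ ≤ 1 / 5) :
    |(logFactor z).im| ≤ 468 / 10000 := by
  refine (abs_logFactor_im_le_of_quartic (by norm_num) (by norm_num)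
    (by norm_num) (fun x => ?_) (fun x => ?_) hz).trans (arctan_le_self (by norm_num))
  · nlinarith [sq_nonneg (x + 51 / 100)]
  · nlinarith [sq_nonneg ((x + 1539 / 10000) * (x - 132 / 1000)), sq_nonneg (x + 1539 / 10000),
      sq_nonneg x]

/-- A cruder bound, from `exp (logFactor z) = 1 + z ^ 2 / (1 + z)`. -/
theorem abs_logFactor_im_le_of_norm_le {z : ℂ} {r : ℝ} (hr : r ≤ 1 / 2) (hz : ‖z‖ ≤ r) :
    |(logFactor z).im| ≤ r ^ 2 / (1 - r - r ^ 2) := by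
  have hr0 : 0 ≤ r := (norm_nonneg z).trans hz
  have hz1 : ‖z‖ < 1 := by linarith
  set E := Complex.exp (logFactor z) with hE
  have hden : 0 < 1 - r - r ^ 2 := by nlinarith
  have hmul : (E - 1) * (1 + z) = z ^ 2 := by linear_combination exp_logFactor_mul hz1
  have hlow : 1 - r ≤ ‖1 + z‖ := by
    have := norm_sub_le (1 + z) z
    rw [add_sub_cancel_right, norm_one] at this
    linarith
  have hnorm : ‖E - 1‖ * (1 - r) ≤ r ^ 2 := by
    calc ‖E - 1‖ * (1 - r) ≤ ‖E - 1‖ * ‖1 + z‖ := by gcongr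
      _ = ‖z‖ ^ 2 := by rw [← norm_mul, hmul, norm_pow]
      _ ≤ r ^ 2 := by gcongr
  have him : |E.im| ≤ ‖E - 1‖ := by simpa using Complex.abs_im_le_norm (E - 1)
  have hre : 1 - ‖E - 1‖ ≤ E.re := by
    have := (abs_le.1 (Complex.abs_re_le_norm (E - 1))).1
    simp only [Complex.sub_re, Complex.one_re] at this
    linarith
  have hn0 := norm_nonneg (E - 1)
  have hn1 : ‖E - 1‖ < 1 := by nlinarith
  refine (abs_logFactor_im_le_arctan hz1 (τ := r ^ 2 / (1 - r - r ^ 2)) (by linarith) ?_).trans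
    (arctan_le_self (by positivity))
  refine him.trans ?_
  rw [div_mul_eq_mul_div, le_div_iff₀ hden]
  nlinarith [sq_nonneg r]

/-! ### The total argument -/

theorem summable_neg_log_one_sub_prime_inv_sq :
    Summable fun p : Nat.Primes => -Real.log (1 - (((p : ℕ) : ℝ)⁻¹) ^ 2) := by
  have h := (Real.summable_log_one_add_of_summable
    ((summable_prime_inv_sq.mul_left (-(1 / 3))))).neg
  refine h.congr fun p => ?_
  change -Real.log (1 + -(1 / 3) * (3 * (((p : ℕ) : ℝ)⁻¹) ^ 2)) = _
  congr 2
  ring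

/-- The Euler product for `ζ(2) = π² / 6`. -/
theorem exp_tsum_neg_log_one_sub_prime_inv_sq :
    Real.exp (∑' p : Nat.Primes, -Real.log (1 - (((p : ℕ) : ℝ)⁻¹) ^ 2)) = Real.pi ^ 2 / 6 := by
  have h := riemannZeta_eulerProduct_exp_log (s := 2) (by simp)
  rw [riemannZeta_two] at h
  have h2 : ∑' p : Nat.Primes, -Complex.log (1 - ((p : ℕ) : ℂ) ^ (-(2 : ℂ)))
      = ((∑' p : Nat.Primes, -Real.log (1 - (((p : ℕ) : ℝ)⁻¹) ^ 2) : ℝ) : ℂ) := by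
    rw [Complex.ofReal_tsum]
    refine tsum_congr fun p => ?_
    have hp := prime_inv_le_half p
    have hp0 : 0 ≤ ((p : ℕ) : ℝ)⁻¹ := by positivity
    rw [Complex.ofReal_neg, Complex.ofReal_log (by nlinarith), Complex.cpow_neg]
    push_cast
    rw [inv_pow]
    norm_cast
  rw [h2] at h
  exact_mod_cast h

/-- If the Euler factors at `2` of the primes in `S` are together those of `2, 3, 5, 7`, the remaining
ones satisfy `∑ -log (1 - p⁻²) ≤ 0.0309`. -/
theorem tsum_compl_neg_log_le (S : Finset Nat.Primes)
    (hS : ∑ p ∈ S, -Real.log (1 - (((p : ℕ) : ℝ)⁻¹) ^ 2)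
      = -Real.log (3 / 4 * (8 / 9) * (24 / 25) * (48 / 49))) :
    ∑' p : ↥((S : Set Nat.Primes)ᶜ), -Real.log (1 - ((((p : Nat.Primes) : ℕ) : ℝ)⁻¹) ^ 2)
      ≤ 309 / 10000 := by
  have h1 := summable_neg_log_one_sub_prime_inv_sq.sum_add_tsum_compl (s := S)
  have h2 := exp_tsum_neg_log_one_sub_prime_inv_sq
  rw [← h1, hS, Real.exp_add, Real.exp_neg, Real.exp_log (by norm_num)] at h2
  refine Real.exp_le_exp.1 ?_
  have h3 := Real.quadratic_le_exp_of_nonneg (x := 309 / 10000) (by norm_num)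
  have hpi := Real.pi_lt_d4
  have hpi0 := Real.pi_pos
  have hpi2 : Real.pi ^ 2 ≤ 3.1416 ^ 2 := by gcongr
  rw [inv_mul_eq_iff_eq_mul₀ (by norm_num)] at h2
  rw [h2]
  norm_num at h3 hpi2 ⊢
  linarith

/-- The arguments of the Euler factors of `2, 3, 5, 7` are at most `0.3764, 0.146, 0.0468, 1 / 41`,
and those of the primes `p ≥ 11` add up to at most `0.0344`, by comparison with `ζ(2)`. The total
`0.6280` is less than `π / 5 = 0.6283…`. -/
theorem abs_twistedLog_im_lt (χ : Nat.Primes → Circle) {s : ℂ} (hs : 1 < s.re) :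
    |(twistedLog χ s).im| < Real.pi / 5 := by
  set a : Nat.Primes → ℝ := fun p => |(logFactor (χ p * ((p : ℕ) : ℂ) ^ (-s))).im| with ha
  set L : Nat.Primes → ℝ := fun p => -Real.log (1 - (((p : ℕ) : ℝ)⁻¹) ^ 2) with hL
  have hz : ∀ p : Nat.Primes, ‖(χ p : ℂ) * ((p : ℕ) : ℂ) ^ (-s)‖ ≤ ((p : ℕ) : ℝ)⁻¹ := fun p =>
    norm_circle_mul_cpow_le _ p hs.le
  have hfsum : Summable fun p : Nat.Primes => logFactor (χ p * ((p : ℕ) : ℂ) ^ (-s)) :=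
    Summable.of_norm_bounded summable_prime_inv_sq fun p => norm_logFactor_le_inv_sq p (hz p)
  have hasum : Summable a := Summable.of_nonneg_of_le (fun p => abs_nonneg _)
    (fun p => (Complex.abs_im_le_norm _).trans (norm_logFactor_le_inv_sq p (hz p)))
    summable_prime_inv_sq
  have hle : |(twistedLog χ s).im| ≤ ∑' p, a p := by
    rw [twistedLog, Complex.im_tsum hfsum]
    exact norm_tsum_le_tsum_norm (f := fun p : Nat.Primes =>
      (logFactor (χ p * ((p : ℕ) : ℂ) ^ (-s))).im) hasum
  set p2 : Nat.Primes := ⟨2, Nat.prime_two⟩ with hp2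
  set p3 : Nat.Primes := ⟨3, Nat.prime_three⟩ with hp3
  set p5 : Nat.Primes := ⟨5, Nat.prime_five⟩ with hp5
  set p7 : Nat.Primes := ⟨7, by norm_num⟩ with hp7
  set S : Finset Nat.Primes := {p2, p3, p5, p7} with hS
  have hsumS : ∀ f : Nat.Primes → ℝ, ∑ p ∈ S, f p = f p2 + (f p3 + (f p5 + f p7)) := by
    intro f
    have hne : ∀ {p q : Nat.Primes}, (p : ℕ) ≠ (q : ℕ) → p ≠ q := fun h e =>
      h (congrArg (fun p : Nat.Primes => (p : ℕ)) e)
    have n23 : p2 ≠ p3 := hne (show (2 : ℕ) ≠ 3 by norm_num)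
    have n25 : p2 ≠ p5 := hne (show (2 : ℕ) ≠ 5 by norm_num)
    have n27 : p2 ≠ p7 := hne (show (2 : ℕ) ≠ 7 by norm_num)
    have n35 : p3 ≠ p5 := hne (show (3 : ℕ) ≠ 5 by norm_num)
    have n37 : p3 ≠ p7 := hne (show (3 : ℕ) ≠ 7 by norm_num)
    have n57 : p5 ≠ p7 := hne (show (5 : ℕ) ≠ 7 by norm_num)
    rw [hS, Finset.sum_insert (by simp [n23, n25, n27]), Finset.sum_insert (by simp [n35, n37]),
      Finset.sum_insert (by simp [n57]), Finset.sum_singleton]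
  have hLS : ∑ p ∈ S, L p = -Real.log (3 / 4 * (8 / 9) * (24 / 25) * (48 / 49)) := by
    rw [hsumS, Real.log_mul (by norm_num) (by norm_num), Real.log_mul (by norm_num) (by norm_num),
      Real.log_mul (by norm_num) (by norm_num)]
    simp only [hL, hp2, hp3, hp5, hp7]
    norm_num
    ring
  have h2 : a p2 ≤ 3764 / 10000 :=
    abs_logFactor_im_le_of_norm_le_half ((hz p2).trans (by simp [hp2]))
  have h3 : a p3 ≤ 146 / 1000 :=
    abs_logFactor_im_le_of_norm_le_third ((hz p3).trans (by simp [hp3]))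
  have h5 : a p5 ≤ 468 / 10000 :=
    abs_logFactor_im_le_of_norm_le_fifth ((hz p5).trans (by simp [hp5]))
  have h7 : a p7 ≤ 1 / 41 := by
    refine (abs_logFactor_im_le_of_norm_le (r := 1 / 7) (by norm_num)
      ((hz p7).trans (by simp [hp7]))).trans ?_
    norm_num
  -- `1 / (p ^ 2 - p - 1) ≤ (121 / 109) / p ^ 2` for `p ≥ 11`, with equality at `11`.
  have htail : ∀ p : ↥((S : Set Nat.Primes)ᶜ), a p ≤ 121 / 109 * L p := by
    rintro ⟨p, hp⟩
    have hp11 : 11 ≤ (p : ℕ) := by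
      have hpp := p.2
      have hne : ∀ q ∈ S, (p : ℕ) ≠ q := fun q hq h => hp (by
        rw [Subtype.ext h]; exact hq)
      have n2 := hne p2 (by simp [hS])
      have n3 := hne p3 (by simp [hS])
      have n5 := hne p5 (by simp [hS])
      have n7 := hne p7 (by simp [hS])
      simp only [hp2, hp3, hp5, hp7] at n2 n3 n5 n7
      by_contra! hlt
      have key : ∀ n < 11, n.Prime → n = 2 ∨ n = 3 ∨ n = 5 ∨ n = 7 := by decide
      rcases key p hlt hpp with h | h | h | h
      · exact n2 h
      · exact n3 h
      · exact n5 h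
      · exact n7 h
    have hP : (11 : ℝ) ≤ ((p : ℕ) : ℝ) := by exact_mod_cast hp11
    set x : ℝ := ((p : ℕ) : ℝ)⁻¹ with hx
    have hx0 : 0 < x := by positivity
    have hx11 : x ≤ 1 / 11 := by
      rw [hx, one_div]; exact inv_anti₀ (by norm_num) hP
    have h1 := abs_logFactor_im_le_of_norm_le (prime_inv_le_half p) (hz p)
    have hlog : x ^ 2 ≤ L p := by
      have := Real.log_le_sub_one_of_pos (show 0 < 1 - x ^ 2 by nlinarith)
      simp only [hL]
      linarith
    refine h1.trans (le_trans ?_ (mul_le_mul_of_nonneg_left hlog (by norm_num)))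
    rw [div_le_iff₀ (by nlinarith)]
    have : 0 ≤ x ^ 2 * ((1 / 11 - x) * (x + 12 / 11)) := by
      have : 0 ≤ 1 / 11 - x := by linarith
      positivity
    nlinarith
  have hLsum := summable_neg_log_one_sub_prime_inv_sq
  have hcompl : ∑' p : ↥((S : Set Nat.Primes)ᶜ), a p ≤ 121 / 109 * (309 / 10000) := by
    refine (Summable.tsum_le_tsum htail (hasum.subtype _)
      ((hLsum.subtype _).mul_left _)).trans ?_
    rw [tsum_mul_left]
    exact mul_le_mul_of_nonneg_left (tsum_compl_neg_log_le S hLS) (by norm_num)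
  rw [← hasum.sum_add_tsum_compl (s := S), hsumS] at hle
  have hpi := Real.pi_gt_d4
  norm_num at hpi hcompl h2 h3 h5 h7
  linarith

/-- At a zero, `k` times the argument of `ζ(2s) / ζ(3s)` is an odd multiple of `π`. -/
theorem riemannZeta_pow_add_pow_ne_zero {k : ℕ} (hk : 1 ≤ k) (hk5 : k ≤ 5) {s : ℂ}
    (hs : 1 < s.re) : riemannZeta (2 * s) ^ k + riemannZeta (3 * s) ^ k ≠ 0 := by
  intro h
  rw [riemannZeta_pow_add_pow_eq_zero_iff hs, ← Complex.exp_pi_mul_I,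
    Complex.exp_eq_exp_iff_exists_int] at h
  obtain ⟨n, hn⟩ := h
  have him := congrArg Complex.im hn
  have hval : (k : ℝ) * (twistedLog 1 s).im = Real.pi * (1 + 2 * n) := by
    simp at him
    linarith
  have hodd : (1 : ℝ) ≤ |1 + 2 * (n : ℝ)| := by
    have : (1 : ℤ) ≤ |1 + 2 * n| := Int.one_le_abs (by omega)
    exact_mod_cast this
  have hlt := abs_twistedLog_im_lt 1 hs
  have habs : (k : ℝ) * |(twistedLog 1 s).im| = Real.pi * |1 + 2 * (n : ℝ)| := by
    have h := congrArg abs hval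
    rwa [abs_mul, abs_mul, Nat.abs_cast, abs_of_pos Real.pi_pos] at h
  have hk1 : (1 : ℝ) ≤ k := by exact_mod_cast hk
  have hk5' : (k : ℝ) ≤ 5 := by exact_mod_cast hk5
  have hpi := Real.pi_pos
  have h0 := abs_nonneg (twistedLog 1 s).im
  nlinarith

theorem theorem3 :
    (∀ k : ℕ, 9 ≤ k →
      {s : ℂ | 1 < s.re ∧ riemannZeta (2 * s) ^ k + riemannZeta (3 * s) ^ k = 0}.Infinite) ∧
    (∀ k : ℕ, 1 ≤ k → k ≤ 5 → ∀ s : ℂ, 1 < s.re →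
      riemannZeta (2 * s) ^ k + riemannZeta (3 * s) ^ k ≠ 0) :=
  ⟨fun _ hk => infinite_setOf_zeros hk,
    fun _ hk hk5 _ hs => riemannZeta_pow_add_pow_ne_zero hk hk5 hs⟩
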